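/- Let $\mathcal C$ be a nonsingular irreducible projective curve over $\overline{\mathbb Q}$, and let $G$ be a connected algebraic group over the function field $K=\overline{\mathbb Q}(\mathcal C)$, written additively. Let $\mathcal G\to\mathcal C$ be a model of $G$, that is, a separated group scheme, locally of finite type over $\mathcal C$, whose generic fibre is identified with $G$ as a group scheme; let $\mathcal O\subset\mathcal G$ be the image of its identity section. For a point $P\in G(K)$ let $\sigma_P$ be the corresponding section of $\mathcal G\to\mathcal C$, defined on the largest open subset $U_P\subseteq\mathcal C$ to which $P$ extends (so $U_P=\mathcal C$ if $P$ extends to a section over all of $\mathcal C$). If $P\neq 0$, let $D_P$ be the effective divisor on $\mathcal C$ given by the scheme-theoretic intersection of $\sigma_P(U_P)$ with $\mathcal O$, viewed through $\sigma_P$ as a closed subscheme of $U_P$. That is, for a closed point $\gamma\in\mathcal C$, $\operatorname{ord}_\gamma D_P$ is the length of the local ring of $\sigma_P^{-1}(\mathcal O)$ at $\gamma$ if $\gamma\in U_P$ and $\sigma_P(\gamma)\in\mathcal O$, and $\operatorname{ord}_\gamma D_P=0$ otherwise. Let $P\in G(K)$ be a nontorsion point, and let $\gamma$ be a closed point of $\mathcal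 C$. Then: 1. if $\operatorname{ord}_\gamma D_P\ge 1$, then $\operatorname{ord}_\gamma D_{nP}=\operatorname{ord}_\gamma D_P$ for all integers $n\neq 0$; 2. there is an integer $m=m(\mathcal G,P,\gamma)\ge 0$ such that $\operatorname{ord}_\gamma D_{nP}\in\{0,m\}$ for all integers $n\neq 0$; in particular $\operatorname{ord}_\gamma D_{nP}$ is finite and bounded independently of $n$. -/

import Mathlib

open CategoryTheory CategoryTheory.Limits AlgebraicGeometry
open scoped MonoidalCategory MonObj Obj

noncomputable section

namespace GeometricDivisibility

/-- A nonsingular irreducible projective curve over `ℚ̄`: an integral scheme, proper and smooth of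
relative dimension one over `ℚ̄` (for such curves proper and projective are the same). -/
structure Curve where
  /-- The underlying scheme. -/
  X : Scheme.{0}
  /-- The structure morphism to `Spec ℚ̄`. -/
  π : X ⟶ Spec (.of (AlgebraicClosure ℚ))
  [isIntegral : IsIntegral X]
  [isProper : IsProper π]
  [smooth : SmoothOfRelativeDimension 1 π]

attribute [instance] Curve.isIntegral Curve.isProper Curve.smooth

namespace Curve

variable (C : Curve)

/-- The spectrum of the function field `ℚ̄(𝒞)`. -/
abbrev specK : Scheme.{0} := Spec C.X.functionField

/-- The inclusion `Spec ℚ̄(𝒞) ⟶ 𝒞` of the generic point. -/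
abbrev generic : C.specK ⟶ C.X := C.X.fromSpecStalk (genericPoint C.X)

instance isSeparated : C.X.IsSeparated :=
  ⟨by
    rw [← terminal.comp_from C.π]
    infer_instance⟩

/-- The group `G(ℚ̄(𝒞))` of rational points of a group scheme `G` over the function field `ℚ̄(𝒞)`.
Its group structure, `Hom.group`, is written multiplicatively by Mathlib:
`P ^ n` is the multiple `nP`. -/
abbrev Points (G : Over C.specK) : Type := 𝟙_ (Over C.specK) ⟶ G

end Curve

/-- A model over the curve `𝒞` of a group scheme `G` over the function field `ℚ̄(𝒞)`:
a separated group scheme, locally of finite type over `𝒞`, together with an isomorphism of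
group schemes between its generic fibre and `G`. -/
structure Model (C : Curve) (G : Over C.specK) [GrpObj G] where
  /-- The group scheme `𝒢` over `𝒞`. -/
  𝒢 : Over C.X
  [grpObj : GrpObj 𝒢]
  [isSeparated : IsSeparated 𝒢.hom]
  [locallyOfFiniteType : LocallyOfFiniteType 𝒢.hom]
  /-- The identification of the generic fibre of `𝒢` with `G`. -/
  genericFibre : (Over.pullback C.generic).obj 𝒢 ≅ G
  [isMonHom : IsMonHom genericFibre.hom]

attribute [instance] Model.grpObj Model.isSeparated Model.locallyOfFiniteType Model.isMonHom

/-- The stalk at `x` of an ideal sheaf `I`, as an ideal of the local ring of `X` at `x`. -/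
def stalkIdeal {X : Scheme.{0}} (I : X.IdealSheafData) (x : X) : Ideal (X.presheaf.stalk x) :=
  ⨆ U : {U : X.affineOpens // x ∈ U.1},
    (I.ideal U.1).map (X.presheaf.germ U.1.1 x U.2).hom

/-- The multiplicity at `x` of the closed subscheme defined by an ideal sheaf `I`, that is, the
length of its local ring `𝒪_{X,x} / I_x`. On a nonsingular curve this is the coefficient at the
closed point `x` of the effective divisor defined by `I`. -/
def mult {X : Scheme.{0}} (I : X.IdealSheafData) (x : X) : ℕ∞ :=
  Module.length (X.presheaf.stalk x) (X.presheaf.stalk x ⧸ stalkIdeal I x)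

namespace Model

variable {C : Curve} {G : Over C.specK} [GrpObj G] (M : Model C G) (P : C.Points G)

instance isSeparated_left : M.𝒢.left.IsSeparated :=
  ⟨by
    rw [← terminal.comp_from M.𝒢.hom]
    infer_instance⟩

/-- A point `P ∈ G(ℚ̄(𝒞))` as a morphism `Spec ℚ̄(𝒞) ⟶ G ≅ 𝒢_η ⟶ 𝒢`. -/
def genericMap : C.specK ⟶ M.𝒢.left :=
  P.left ≫ M.genericFibre.inv.left ≫ pullback.fst M.𝒢.hom C.generic

lemma genericMap_hom : M.genericMap P ≫ M.𝒢.hom = C.generic ≫ 𝟙 C.X := by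
  have h : (P ≫ M.genericFibre.inv).left ≫ pullback.snd M.𝒢.hom C.generic = 𝟙 C.specK :=
    Over.w (P ≫ M.genericFibre.inv)
  rw [Over.comp_left, Category.assoc] at h
  rw [genericMap, Category.assoc, Category.assoc, pullback.condition, reassoc_of% h,
    Category.comp_id]
  exact Category.id_comp _

/-- The section `σ_P` of `𝒢 ⟶ 𝒞` corresponding to `P`, on the largest open subset of `𝒞` to which
`P` extends (which is `𝒞` itself if `P` extends to a section over all of `𝒞`). -/
def sectionOf : C.X.PartialMap M.𝒢.left :=
  (Scheme.RationalMap.ofFunctionField (𝟙 C.X) M.𝒢.hom (M.genericMap P)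
    (M.genericMap_hom P)).toPartialMap

/-- The identity section `𝒪 : 𝒞 ⟶ 𝒢`. -/
def identitySection : C.X ⟶ M.𝒢.left := (MonObj.one (X := M.𝒢)).left

/-- The ideal sheaf of the scheme-theoretic intersection of `σ_P` and `𝒪`, viewed through `σ_P` as a
closed subscheme of the domain of `σ_P`: the inverse image `σ_P⁻¹(𝒪)`. -/
def intersection : (M.sectionOf P).domain.toScheme.IdealSheafData :=
  Scheme.Hom.ker (pullback.fst (M.sectionOf P).hom M.identitySection)

open Classical in
/-- The order `ord_c D_P` at `c` of the divisor `D_P` of the point `P`: the multiplicity at `c` of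
the intersection of `σ_P` with the identity section (so it is `0` if they do not meet above `c`, in
particular if `P` does not extend to a section near `c`). It is `∞` exactly when the intersection
contains a neighbourhood of `c`, as happens for `P = 0`, for which `D_P` is not a divisor. -/
def ord (c : C.X) : ℕ∞ :=
  if h : c ∈ (M.sectionOf P).domain then mult (M.intersection P) ⟨c, h⟩ else 0

end Model

end GeometricDivisibility

end

/-! Let R be the local ring of the curve at c: a Noetherian local domain of dimension at most one in
which every nonzero integer is a unit. If P extends at c, it is a section over Spec R, and the ideal
J of the intersection with the identity section is characterised by a universal property: P becomes
trivial over Q along R → Q exactly when J maps to zero (`localIdeal_le_ker_iff_comp_eq_one`). Let J'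
be the corresponding ideal for nP. Triviality of P modulo J gives J' ≤ J.

For the converse, assume J proper and work modulo K = J' + J². There nP is trivial and P is trivial
modulo the square-zero ideal J/K. Points reducing to the identity modulo a square-zero ideal
multiply by adding tangent vectors, so the n-th power multiplies the tangent vector by the unit n
(`pointOf_mul`, `pointOf_pow`). Hence P is trivial modulo K, so J ≤ J' + J², and Nakayama gives J ≤
J'. Thus J = J', which is the first claim (`localIdeal_zpow`).

For the second claim, if kP and nP both have positive order at c, the first claim identifies both
orders with that of nkP. The common value is finite because kP ≠ 0 makes its ideal nonzero, and
nonzero ideals of R have finite colength (`ord_ne_top`). -/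

/-! ### Commutative algebra: dimension at most one and finite colength. -/

open Polynomial in
/-- An algebra which is standard smooth of relative dimension one is formally unramified over a
polynomial ring in one variable. -/
theorem Algebra.IsStandardSmoothOfRelativeDimension.exists_formallyUnramified_polynomial
    (k S : Type*) [CommRing k] [CommRing S] [Nontrivial S] [Algebra k S]
    [Algebra.IsStandardSmoothOfRelativeDimension 1 k S] :
    ∃ x : S, letI := (aeval (R := k) x).toAlgebra; Algebra.FormallyUnramified k[X] S := by
  obtain ⟨I, J, _, _, P, hP⟩ :=
    Algebra.IsStandardSmoothOfRelativeDimension.out (n := 1) (R := k) (S := S)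
  have := Fintype.ofFinite I
  have hrank : Module.finrank S (Ω[S⁄k]) = 1 := by
    rw [Module.finrank, P.rank_kaehlerDifferential, hP]; simp
  have hfin : Finite ((Set.range P.map)ᶜ : Set _) := Subtype.finite
  have := Fintype.ofFinite ((Set.range P.map)ᶜ : Set _)
  have hcard : Fintype.card ((Set.range P.map)ᶜ : Set _) = 1 := by
    rw [← hrank, Module.finrank_eq_card_basis P.basisKaehler]
  obtain ⟨i, hi⟩ := Fintype.card_eq_one_iff.mp hcard
  -- Ω[S⁄k] has a basis of differentials of the generators outside the range of `P.map`; rank one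
  -- leaves a single such generator, and its differential dies over k[X].
  refine ⟨P.val i, ?_⟩
  let := (aeval (R := k) (P.val i)).toAlgebra
  have : IsScalarTower k k[X] S := IsScalarTower.of_algebraMap_eq fun r => by
    simp [RingHom.algebraMap_toAlgebra]
  refine ⟨⟨fun a b => ?_⟩⟩
  suffices h : ∀ a : Ω[S⁄k[X]], a = 0 by rw [h a, h b]
  intro a
  obtain ⟨w, rfl⟩ := KaehlerDifferential.map_surjective k k[X] S a
  have hw := P.basisKaehler.sum_repr w
  have : Unique ((Set.range P.map)ᶜ : Set _) := ⟨⟨i⟩, hi⟩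
  rw [Fintype.sum_unique] at hw
  have hd : (default : ((Set.range P.map)ᶜ : Set _)) = i := hi _
  rw [← hw, hd, map_smul, Algebra.SubmersivePresentation.basisKaehler_apply,
    KaehlerDifferential.map_D]
  have : algebraMap S S (P.val i) = algebraMap k[X] S X := by
    simp [RingHom.algebraMap_toAlgebra]
  rw [this, Derivation.map_algebraMap, smul_zero]

/-- A domain that is quasi-finite over a ring of dimension at most one has dimension at most
one. -/
theorem Ring.DimensionLEOne.of_quasiFinite (A S : Type*) [CommRing A] [CommRing S] [IsDomain S]
    [Algebra A S] [Algebra.QuasiFinite A S] [Ring.DimensionLEOne A] : Ring.DimensionLEOne S where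
  maximalOfPrime {p} hp0 hp := by
    obtain ⟨q, hq, hpq⟩ := p.exists_le_maximal hp.ne_top
    -- Distinct primes in one fibre of a quasi-finite map are incomparable. Hence a nonzero p
    -- contracts to a nonzero, so maximal, prime, and any maximal q ≥ p lies in the same fibre.
    have hne : p.under A ≠ (⊥ : Ideal S).under A := fun h =>
      hp0 (Algebra.QuasiFinite.eq_of_le_of_under_eq (R := A) ⊥ p bot_le h.symm).symm
    have hp' : p.under A ≠ ⊥ := fun h => hne (by
      refine le_antisymm ?_ (Ideal.comap_mono bot_le)
      rw [h]; exact bot_le)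
    have hmax : (p.under A).IsMaximal := Ring.DimensionLEOne.maximalOfPrime hp' inferInstance
    have := hq.isPrime
    have heq : p.under A = q.under A :=
      hmax.eq_of_le (Ideal.IsPrime.under A q).ne_top (Ideal.comap_mono hpq)
    rw [Algebra.QuasiFinite.eq_of_le_of_under_eq (R := A) p q hpq heq]
    exact hq

-- Finite type and formally unramified over k[X] means quasi-finite over a principal ideal domain,
-- so the dimension bound passes up.
open Polynomial in
theorem Algebra.IsStandardSmoothOfRelativeDimension.dimensionLEOne
    (k S : Type*) [Field k] [CommRing S] [IsDomain S] [Algebra k S]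
    [Algebra.IsStandardSmoothOfRelativeDimension 1 k S] : Ring.DimensionLEOne S := by
  obtain ⟨x, hx⟩ := exists_formallyUnramified_polynomial k S
  let := (aeval (R := k) x).toAlgebra
  have : IsScalarTower k k[X] S := IsScalarTower.of_algebraMap_eq fun r => by
    simp [RingHom.algebraMap_toAlgebra]
  have := Algebra.IsStandardSmoothOfRelativeDimension.isStandardSmooth 1 (R := k) (S := S)
  have : Algebra.FiniteType k S := inferInstance
  have : Algebra.FiniteType k[X] S := .of_restrictScalars_finiteType k k[X] S
  exact .of_quasiFinite k[X] S

theorem Ideal.isFiniteLength_quotient {R : Type*} [CommRing R] [IsDomain R] [IsNoetherianRing R]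
    [Ring.KrullDimLE 1 R] {I : Ideal R} (hI : I ≠ ⊥) : IsFiniteLength R (R ⧸ I) := by
  obtain ⟨a, ha, ha0⟩ := Submodule.exists_mem_ne_zero_of_ne_bot hI
  have := isFiniteLength_quotient_span_singleton R (mem_nonZeroDivisors_of_ne_zero ha0)
  exact this.of_surjective (f := Submodule.factor ((Ideal.span_singleton_le_iff_mem I).mpr ha))
    (Submodule.factor_surjective _)

theorem Ideal.length_quotient_map_ringEquiv {R S : Type*} [CommRing R] [CommRing S]
    (e : R ≃+* S) (I : Ideal R) :
    Module.length S (S ⧸ I.map (e : R →+* S)) = Module.length R (R ⧸ I) := by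
  let := (e : R →+* S).toAlgebra
  rw [← Module.length_eq_of_surjective (S := R) (R := S) e.surjective]
  let f : (R ⧸ I) ≃ₗ[R] (S ⧸ I.map (e : R →+* S)) :=
    { Ideal.quotientEquiv I _ e rfl with
      map_smul' := fun r x => by
        obtain ⟨x, rfl⟩ := Ideal.Quotient.mk_surjective x
        exact map_mul (Ideal.quotientEquiv I _ e rfl) (Ideal.Quotient.mk I r)
          (Ideal.Quotient.mk I x) }
  exact f.length_eq.symm

/-! ### Group scheme points that are trivial modulo a square-zero ideal. -/

noncomputable section

namespace GeometricDivisibility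

theorem specMap_surjective {R R' : CommRingCat.{0}} (q : R ⟶ R')
    (hq : Function.Surjective q) (hn : ∀ a, q a = 0 → IsNilpotent a) :
    Function.Surjective (Spec.map q) := by
  rw [← Set.range_eq_univ]
  refine (range_comap_of_surjective _ q.hom hq).trans ?_
  exact (PrimeSpectrum.zeroLocus_eq_univ_iff _).mpr fun a ha => hn a ha

/-- The threefold fibre product of a ring `R` with itself over a ring homomorphism `q : R → R'`. -/
def tripleFibreProduct {R R' : Type*} [CommRing R] [CommRing R'] (q : R →+* R') :
    Subring (R × R × R) where
  carrier := {x | q x.2.1 = q x.1 ∧ q x.2.2 = q x.1}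
  mul_mem' := by rintro a b ⟨h1, h2⟩ ⟨h3, h4⟩; simp_all
  one_mem' := by simp
  add_mem' := by rintro a b ⟨h1, h2⟩ ⟨h3, h4⟩; simp_all
  zero_mem' := by simp
  neg_mem' := by rintro a ⟨h1, h2⟩; simp_all

namespace tripleFibreProduct

variable {R R' B : Type*} [CommRing R] [CommRing R'] [CommRing B] (q : R →+* R')

/-- The first projection. -/
def proj₀ : tripleFibreProduct q →+* R := (RingHom.fst R (R × R)).comp (Subring.subtype _)

/-- The second projection. -/
def proj₁ : tripleFibreProduct q →+* R :=
  ((RingHom.fst R R).comp (RingHom.snd R (R × R))).comp (Subring.subtype _)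

/-- The third projection. -/
def proj₂ : tripleFibreProduct q →+* R :=
  ((RingHom.snd R R).comp (RingHom.snd R (R × R))).comp (Subring.subtype _)

/-- The ring homomorphism into the fibre product with the given components. -/
def lift (f₀ f₁ f₂ : B →+* R) (h₁ : q.comp f₁ = q.comp f₀) (h₂ : q.comp f₂ = q.comp f₀) :
    B →+* tripleFibreProduct q :=
  (f₀.prod (f₁.prod f₂)).codRestrict _ fun x =>
    ⟨congr($h₁ x), congr($h₂ x)⟩

variable {q} in
/-- Addition of tangent vectors: `(r, r + a, r + b) ↦ r + a + b`, where `a` and `b` lie in the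
square-zero kernel of `q`. -/
def sum (hq : ∀ a b, q a = 0 → q b = 0 → a * b = 0) : tripleFibreProduct q →+* R where
  toFun x := x.1.2.1 + x.1.2.2 - x.1.1
  map_one' := by simp
  map_zero' := by simp
  map_add' x y := by simp; ring
  map_mul' := by
    rintro ⟨⟨r, a, b⟩, ha, hb⟩ ⟨⟨r', a', b'⟩, ha', hb'⟩
    simp only at ha hb ha' hb'
    have h1 := hq (a - r) (b' - r') (by simp [ha]) (by simp [hb'])
    have h2 := hq (b - r) (a' - r') (by simp [hb]) (by simp [ha'])
    change a * a' + b * b' - r * r' = (a + b - r) * (a' + b' - r')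
    linear_combination -h1 - h2

variable {q} in
theorem hom_ext {f g : B →+* tripleFibreProduct q} (h₀ : (proj₀ q).comp f = (proj₀ q).comp g)
    (h₁ : (proj₁ q).comp f = (proj₁ q).comp g) (h₂ : (proj₂ q).comp f = (proj₂ q).comp g) :
    f = g :=
  RingHom.ext fun x => Subtype.ext
    (Prod.ext congr($h₀ x) (Prod.ext congr($h₁ x) congr($h₂ x)))

/-- The kernel of the first projection has elements of square zero. Consequently a point over the
triple product lies in a chart as soon as its first projection does. -/
theorem specMap_proj₀_surjective {R R' : CommRingCat.{0}} (q : R ⟶ R')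
    (hq : ∀ a b, q a = 0 → q b = 0 → a * b = 0) :
    Function.Surjective (Spec.map (CommRingCat.ofHom (proj₀ q.hom))) := by
  refine specMap_surjective _ (fun r => ⟨⟨(r, r, r), rfl, rfl⟩, rfl⟩) ?_
  rintro ⟨⟨r, a, b⟩, ha, hb⟩ (rfl : r = 0)
  simp only [map_zero] at ha hb
  exact ⟨2, Subtype.ext (by simp [pow_two, hq a a ha ha, hq b b hb hb])⟩

end tripleFibreProduct

section Points

variable {S : Scheme.{0}} {G : Over S} {A B R R' : CommRingCat.{0}}
  {w : Spec A ⟶ S} {v : Spec B ⟶ G.left} {α : A ⟶ B} (hv : v ≫ G.hom = Spec.map α ≫ w)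

/-- The point of `G` with values in an `A`-algebra `R` defined by a homomorphism of `A`-algebras
from `B`, where `Spec B ⟶ G` is a morphism over `Spec A ⟶ S`. -/
def pointOf (b : A ⟶ R) (φ : B ⟶ R) (h : α ≫ φ = b) :
    Over.mk (Spec.map b ≫ w) ⟶ G :=
  Over.homMk (Spec.map φ ≫ v) (by simp [hv, ← h])

/-- Change of rings as a morphism over `S`. -/
def specMapOver (w : Spec A ⟶ S) {b : A ⟶ R} {b' : A ⟶ R'} (f : R ⟶ R') (h : b ≫ f = b') :
    Over.mk (Spec.map b' ≫ w) ⟶ Over.mk (Spec.map b ≫ w) :=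
  Over.homMk (Spec.map f) (by simp [← h])

theorem specMapOver_pointOf {b : A ⟶ R} {b' : A ⟶ R'} (f : R ⟶ R') (h : b ≫ f = b')
    (φ : B ⟶ R) (hφ : α ≫ φ = b) (φ' : B ⟶ R') (h' : φ ≫ f = φ') :
    specMapOver w f h ≫ pointOf hv b φ hφ =
      pointOf hv b' φ' (by rw [← h', reassoc_of% hφ, h]) := by
  ext1
  simp [specMapOver, pointOf, ← h']

/-- Landing in the open chart is a condition on underlying points, so it can be checked after a
change of rings that is surjective on spectra. -/
theorem exists_pointOf [IsOpenImmersion v] {b : A ⟶ R} {b' : A ⟶ R'} (f : R ⟶ R') (h : b ≫ f = b')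
    [Mono w]
    (hf : Function.Surjective (Spec.map f)) (x : Over.mk (Spec.map b ≫ w) ⟶ G)
    (φ' : B ⟶ R') (hφ' : α ≫ φ' = b')
    (hx : specMapOver w f h ≫ x = pointOf hv b' φ' hφ') :
    ∃ (φ : B ⟶ R) (hφ : α ≫ φ = b), φ ≫ f = φ' ∧ x = pointOf hv b φ hφ := by
  have hx' : Spec.map f ≫ x.left = Spec.map φ' ≫ v := congr(($hx).left)
  have hr : Set.range x.left ⊆ Set.range v := by
    rintro _ ⟨y, rfl⟩
    obtain ⟨z, rfl⟩ := hf y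
    exact ⟨Spec.map φ' z, congr($hx' z).symm⟩
  let l := IsOpenImmersion.lift v x.left hr
  have hl : l ≫ v = x.left := IsOpenImmersion.lift_fac ..
  have hl' : Spec.map (Spec.preimage l) ≫ v = x.left := by rw [Spec.map_preimage, hl]
  refine ⟨Spec.preimage l, ?_, ?_, ?_⟩
  · apply Spec.map_injective
    rw [Spec.map_comp, ← cancel_mono w, Category.assoc, ← hv, reassoc_of% hl']
    exact Over.w x
  · apply Spec.map_injective
    rw [← cancel_mono v, Spec.map_comp, Category.assoc, hl', hx']
  · ext1
    exact hl'.symm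

-- Over the triple product T, multiply the points (φ₀, φ₁, φ₀) and (φ₀, φ₀, φ₂). Since φ₀ is the
-- identity, the projections show that the product is (φ₀, φ₁, φ₂). The ring map `sum` sends the two
-- factors to φ₁ and φ₂, hence their product to φ₁ + φ₂ - φ₀. Commutativity of G plays no role.
open tripleFibreProduct in
theorem pointOf_mul [GrpObj G] [IsOpenImmersion v] [Mono w] {b : A ⟶ R} (q : R ⟶ R')
    (hq : ∀ a b, q a = 0 → q b = 0 → a * b = 0)
    {φ₀ φ₁ φ₂ : B ⟶ R} (h₀ : α ≫ φ₀ = b) (h₁ : α ≫ φ₁ = b) (h₂ : α ≫ φ₂ = b)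
    (hone : pointOf hv b φ₀ h₀ = 1) (hq₁ : φ₁ ≫ q = φ₀ ≫ q)
    (hq₂ : φ₂ ≫ q = φ₀ ≫ q) :
    ∃ (φ : B ⟶ R) (h : α ≫ φ = b), pointOf hv b φ₁ h₁ * pointOf hv b φ₂ h₂ = pointOf hv b φ h ∧
      φ ≫ q = φ₀ ≫ q ∧ ∀ x, φ x = φ₁ x + φ₂ x - φ₀ x := by
  let T : CommRingCat := .of (tripleFibreProduct q.hom)
  let d : A ⟶ T := CommRingCat.ofHom (lift q.hom b.hom b.hom b.hom rfl rfl)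
  let p₀ : T ⟶ R := CommRingCat.ofHom (proj₀ q.hom)
  let p₁ : T ⟶ R := CommRingCat.ofHom (proj₁ q.hom)
  let p₂ : T ⟶ R := CommRingCat.ofHom (proj₂ q.hom)
  let s : T ⟶ R := CommRingCat.ofHom (sum (q := q.hom) hq)
  have hd₀ : d ≫ p₀ = b := rfl
  have hd₁ : d ≫ p₁ = b := rfl
  have hd₂ : d ≫ p₂ = b := rfl
  have hds : d ≫ s = b := by ext x; exact add_sub_cancel_right _ _
  let ψ₁ : B ⟶ T := CommRingCat.ofHom (lift q.hom φ₀.hom φ₁.hom φ₀.hom congr(($hq₁).hom) rfl)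
  let ψ₂ : B ⟶ T := CommRingCat.ofHom (lift q.hom φ₀.hom φ₀.hom φ₂.hom rfl congr(($hq₂).hom))
  have hψ₁ : α ≫ ψ₁ = d := by
    ext1; refine hom_ext ?_ ?_ ?_
    exacts [congr(($h₀).hom), congr(($h₁).hom), congr(($h₀).hom)]
  have hψ₂ : α ≫ ψ₂ = d := by
    ext1; refine hom_ext ?_ ?_ ?_
    exacts [congr(($h₀).hom), congr(($h₀).hom), congr(($h₂).hom)]
  let x := pointOf hv d ψ₁ hψ₁ * pointOf hv d ψ₂ hψ₂
  have hx₀ : specMapOver w p₀ hd₀ ≫ x = pointOf hv b φ₀ h₀ := by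
    rw [MonObj.comp_mul, specMapOver_pointOf hv p₀ hd₀ ψ₁ hψ₁ φ₀ rfl,
      specMapOver_pointOf hv p₀ hd₀ ψ₂ hψ₂ φ₀ rfl, hone, one_mul]
  have hx₁ : specMapOver w p₁ hd₁ ≫ x = pointOf hv b φ₁ h₁ := by
    rw [MonObj.comp_mul, specMapOver_pointOf hv p₁ hd₁ ψ₁ hψ₁ φ₁ rfl,
      specMapOver_pointOf hv p₁ hd₁ ψ₂ hψ₂ φ₀ rfl, hone, mul_one]
  have hx₂ : specMapOver w p₂ hd₂ ≫ x = pointOf hv b φ₂ h₂ := by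
    rw [MonObj.comp_mul, specMapOver_pointOf hv p₂ hd₂ ψ₁ hψ₁ φ₀ rfl,
      specMapOver_pointOf hv p₂ hd₂ ψ₂ hψ₂ φ₂ rfl, hone, one_mul]
  have hxs : specMapOver w s hds ≫ x = pointOf hv b φ₁ h₁ * pointOf hv b φ₂ h₂ := by
    rw [MonObj.comp_mul, specMapOver_pointOf hv s hds ψ₁ hψ₁ φ₁, 
      specMapOver_pointOf hv s hds ψ₂ hψ₂ φ₂]
    · ext x; exact add_sub_cancel_left _ _
    · ext x; exact add_sub_cancel_right _ _
  obtain ⟨ψ, hψ, hψ₀, hxψ⟩ := exists_pointOf hv p₀ hd₀ (specMap_proj₀_surjective q hq) x φ₀ h₀ hx₀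
  have key {p : T ⟶ R} {hp : d ≫ p = b} {φ : B ⟶ R} {h : α ≫ φ = b}
      (hp' : specMapOver w p hp ≫ x = pointOf hv b φ h) : ψ ≫ p = φ := by
    rw [hxψ, specMapOver_pointOf hv p hp ψ hψ _ rfl] at hp'
    apply Spec.map_injective
    rw [← cancel_mono v]
    exact congr(($hp').left)
  have hk₁ := key hx₁
  have hk₂ := key hx₂
  have hψs (y : B) : (ψ ≫ s) y = φ₁ y + φ₂ y - φ₀ y := by rw [← hk₁, ← hk₂, ← hψ₀]; rfl
  refine ⟨ψ ≫ s, by rw [reassoc_of% hψ, hds], ?_, ?_, hψs⟩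
  · rw [← hxs, hxψ, specMapOver_pointOf hv s hds ψ hψ _ rfl]
  · ext y
    have e₁ : q (φ₁ y) = q (φ₀ y) := congr($hq₁ y)
    have e₂ : q (φ₂ y) = q (φ₀ y) := congr($hq₂ y)
    rw [CommRingCat.comp_apply, hψs, map_sub, map_add, e₁, e₂, add_sub_cancel_right]
    rfl

theorem pointOf_pow [GrpObj G] [IsOpenImmersion v] [Mono w] {b : A ⟶ R} (q : R ⟶ R')
    (hq : ∀ a b, q a = 0 → q b = 0 → a * b = 0)
    {φ₀ φ₁ : B ⟶ R} (h₀ : α ≫ φ₀ = b) (h₁ : α ≫ φ₁ = b)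
    (hone : pointOf hv b φ₀ h₀ = 1) (hq₁ : φ₁ ≫ q = φ₀ ≫ q) (n : ℕ) :
    ∃ (φ : B ⟶ R) (h : α ≫ φ = b), pointOf hv b φ₁ h₁ ^ n = pointOf hv b φ h ∧
      φ ≫ q = φ₀ ≫ q ∧ ∀ x, φ x = φ₀ x + n * (φ₁ x - φ₀ x) := by
  induction n with
  | zero => exact ⟨φ₀, h₀, by simp [hone], rfl, by simp⟩
  | succ n ih =>
    obtain ⟨φ, h, e, hφ, hx⟩ := ih
    obtain ⟨φ', h', e', hφ', hx'⟩ := pointOf_mul hv q hq h₀ h h₁ hone hφ hq₁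
    refine ⟨φ', h', by rw [pow_succ, e, e'], hφ', fun x => ?_⟩
    rw [hx', hx]; push_cast; ring

/-- A version of `eq_one_of_pow_eq_one` in a chart around the identity. -/
theorem eq_one_of_pow_eq_one_of_mem [GrpObj G] [IsOpenImmersion v] [Mono w] [IsLocalRing R]
    {b : A ⟶ R} (q : R ⟶ R') (hqs : Function.Surjective q)
    (hq : ∀ a b, q a = 0 → q b = 0 → a * b = 0) (f : Over.mk (Spec.map b ≫ w) ⟶ G)
    (φ₀ : B ⟶ R) (h₀ : α ≫ φ₀ = b) (hone : pointOf hv b φ₀ h₀ = 1)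
    (hf : Spec.map q ≫ f.left = Spec.map q ≫ (1 : Over.mk (Spec.map b ≫ w) ⟶ G).left) (n : ℕ)
    (hn : IsUnit (n : R)) (hfn : f ^ n = 1) : f = 1 := by
  obtain ⟨φ₁, h₁, hφ₁, rfl⟩ := exists_pointOf hv q rfl
    (specMap_surjective q hqs fun a ha => ⟨2, by rw [pow_two, hq a a ha ha]⟩) f (φ₀ ≫ q)
    (by rw [reassoc_of% h₀]) (by
      rw [← specMapOver_pointOf hv q rfl φ₀ h₀ _ rfl, hone]
      ext1
      exact hf)
  obtain ⟨φ, h, e, -, hφ⟩ := pointOf_pow hv q hq h₀ h₁ hone hφ₁ n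
  rw [hfn, ← hone] at e
  have e' : φ₀ = φ := by
    apply Spec.map_injective
    rw [← cancel_mono v]
    exact congr(($e).left)
  -- Triviality of the power reads φ₀ = φ₀ + n(φ₁ - φ₀), and n is a unit.
  have : φ₁ = φ₀ := by
    ext x
    have := hφ x
    rw [← e', left_eq_add, hn.mul_right_eq_zero, sub_eq_zero] at this
    exact this
  subst this
  exact hone

end Points

/-- Points of a group scheme which reduce to the identity modulo a square-zero ideal have no
`n`-torsion if `n` is invertible. -/
theorem eq_one_of_pow_eq_one {S : Scheme.{0}} {G : Over S} [GrpObj G] {R R' : CommRingCat.{0}}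
    [IsLocalRing R] (g : Spec R ⟶ S) (q : R ⟶ R') (hqs : Function.Surjective q)
    (hq : ∀ a b, q a = 0 → q b = 0 → a * b = 0) (f : Over.mk g ⟶ G)
    (hf : Spec.map q ≫ f.left = Spec.map q ≫ (1 : Over.mk g ⟶ G).left) (n : ℕ)
    (hn : IsUnit (n : R)) (hfn : f ^ n = 1) : f = 1 := by
  let e := (1 : Over.mk g ⟶ G).left
  obtain ⟨_, ⟨W, hW, rfl⟩, hyW, -⟩ := S.isBasis_affineOpens.exists_subset_of_mem_open
    (Set.mem_univ (G.hom (e (IsLocalRing.closedPoint R)))) isOpen_univ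
  obtain ⟨_, ⟨V, hV, rfl⟩, hyV, hVW⟩ := G.left.isBasis_affineOpens.exists_subset_of_mem_open
    (show e (IsLocalRing.closedPoint R) ∈ G.hom ⁻¹ᵁ W from hyW) (G.hom ⁻¹ᵁ W).2
  replace hW : IsAffineOpen W := hW
  replace hV : IsAffineOpen V := hV
  have hv := (hW.SpecMap_appLE_fromSpec G.hom hV hVW).symm
  -- R is local, so an open set containing the image of the closed point contains the whole image of
  -- Spec R: one affine chart suffices.
  have hr : Set.range e ⊆ Set.range hV.fromSpec := by
    rw [hV.range_fromSpec]
    rintro _ ⟨z, rfl⟩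
    exact (Scheme.preimage_eq_top_of_closedPoint_mem (R := R) e hyV).ge (Set.mem_univ z)
  obtain ⟨φ₀, hφ₀⟩ : ∃ φ₀ : Γ(G.left, V) ⟶ R, Spec.map φ₀ ≫ hV.fromSpec = e :=
    ⟨Spec.preimage (IsOpenImmersion.lift hV.fromSpec e hr), by
      rw [Spec.map_preimage, IsOpenImmersion.lift_fac]⟩
  have hg : Spec.map (G.hom.appLE W V hVW ≫ φ₀) ≫ hW.fromSpec = g := by
    rw [Spec.map_comp, Category.assoc, ← hv, reassoc_of% hφ₀]
    exact Over.w (1 : Over.mk g ⟶ G)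
  clear hr hyV hyW
  subst hg
  exact eq_one_of_pow_eq_one_of_mem hv q hqs hq f φ₀ rfl (by ext1; exact hφ₀) hf n hn hfn

end GeometricDivisibility

end

/-! ### Stalks of ideal sheaves and factorisation through closed subschemes. -/

noncomputable section

namespace GeometricDivisibility

theorem specMap_fromSpecStalk_app_eq_zero_iff {X : Scheme.{0}} {x : X} {Q : CommRingCat.{0}}
    (ψ : X.presheaf.stalk x ⟶ Q) {W : X.Opens} (hx : x ∈ W) (s : Γ(X, W)) :
    (Spec.map ψ ≫ X.fromSpecStalk x).app W s = 0 ↔ ψ (X.presheaf.germ W x hx s) = 0 := by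
  have htop : X.fromSpecStalk x ⁻¹ᵁ W = ⊤ :=
    Scheme.preimage_eq_top_of_closedPoint_mem (X.fromSpecStalk x)
      (by rwa [Scheme.fromSpecStalk_closedPoint])
  have htop' : (Spec.map ψ ≫ X.fromSpecStalk x) ⁻¹ᵁ W = ⊤ := by
    rw [Scheme.Hom.comp_preimage, htop]; rfl
  have key : (Spec.map ψ ≫ X.fromSpecStalk x).app W =
      X.presheaf.germ W x hx ≫ ψ ≫ (Scheme.ΓSpecIso Q).inv ≫
        (Spec Q).presheaf.map (homOfLE le_top).op := by
    rw [Scheme.Hom.comp_app, Scheme.fromSpecStalk_app hx, Category.assoc, Category.assoc,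
      Scheme.Hom.naturality]
    exact congr(X.presheaf.germ W x hx ≫ $((Scheme.ΓSpecIso_inv_naturality_assoc ψ _).symm))
  have hmap : IsIso ((Spec Q).presheaf.map
      (homOfLE (le_top : (Spec.map ψ ≫ X.fromSpecStalk x) ⁻¹ᵁ W ≤ ⊤)).op) := by
    have : homOfLE (le_top : (Spec.map ψ ≫ X.fromSpecStalk x) ⁻¹ᵁ W ≤ ⊤) = eqToHom htop' := rfl
    rw [this]; infer_instance
  have hinj := (ConcreteCategory.bijective_of_isIso ((Scheme.ΓSpecIso Q).inv ≫ (Spec Q).presheaf.map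
      (homOfLE (le_top : (Spec.map ψ ≫ X.fromSpecStalk x) ⁻¹ᵁ W ≤ ⊤)).op)).1
  rw [key]
  exact map_eq_zero_iff _ hinj

/-- Links the sheaf-theoretic kernel with algebra in the local ring. A map from Spec Q through the
local scheme at x factors through any affine neighbourhood of x, so one such neighbourhood decides
the inclusion. -/
theorem le_ker_specMap_fromSpecStalk_iff {X : Scheme.{0}} (I : X.IdealSheafData) (x : X)
    {Q : CommRingCat.{0}} (ψ : X.presheaf.stalk x ⟶ Q) :
    I ≤ (Spec.map ψ ≫ X.fromSpecStalk x).ker ↔ stalkIdeal I x ≤ RingHom.ker ψ.hom := by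
  constructor
  · intro h
    refine iSup_le fun U => Ideal.map_le_iff_le_comap.mpr fun s hs => ?_
    exact (specMap_fromSpecStalk_app_eq_zero_iff ψ U.2 s).mp (Scheme.Hom.ideal_ker_le _ _ (h _ hs))
  · intro h
    obtain ⟨_, ⟨U, hU, rfl⟩, hxU, -⟩ := X.isBasis_affineOpens.exists_subset_of_mem_open
      (Set.mem_univ x) isOpen_univ
    replace hU : IsAffineOpen U := hU
    let t' := Spec.map (X.presheaf.germ U x hxU ≫ ψ)
    have ht : Spec.map ψ ≫ X.fromSpecStalk x = t' ≫ hU.fromSpec := by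
      simp only [t', Spec.map_comp, Category.assoc, ← hU.fromSpecStalk_eq_fromSpecStalk hxU]
      rfl
    rw [ht, Scheme.Hom.ker_comp, Scheme.IdealSheafData.le_map_iff_comap_le]
    refine Scheme.IdealSheafData.le_of_isAffine fun y hy => ?_
    rw [Scheme.Hom.ker_apply, RingHom.mem_ker]
    rw [Scheme.IdealSheafData.ideal_comap_of_isOpenImmersion] at hy
    have hxW : x ∈ hU.fromSpec ''ᵁ ⊤ := by simpa using hxU
    have hz : (t' ≫ hU.fromSpec).app (hU.fromSpec ''ᵁ ⊤) ((hU.fromSpec.appIso ⊤).inv y) = 0 := by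
      rw [← ht, specMap_fromSpecStalk_app_eq_zero_iff ψ hxW]
      exact h (Ideal.mem_iSup_of_mem
        (⟨⟨_, (isAffineOpen_top _).image_of_isOpenImmersion hU.fromSpec⟩, hxW⟩ :
          {U : X.affineOpens // x ∈ U.1}) (Ideal.mem_map_of_mem _ hy))
    rw [Scheme.Hom.comp_app] at hz
    replace hz : ((hU.fromSpec.appIso ⊤).inv ≫ hU.fromSpec.app (hU.fromSpec ''ᵁ ⊤) ≫
      t'.app (hU.fromSpec ⁻¹ᵁ hU.fromSpec ''ᵁ ⊤)) y = 0 := hz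
    rw [Scheme.Hom.appIso_inv_app_assoc, Scheme.Hom.naturality] at hz
    have hinj := (ConcreteCategory.bijective_of_isIso ((Spec Q).presheaf.map
      ((TopologicalSpace.Opens.map t'.base).map (eqToHom (show hU.fromSpec ⁻¹ᵁ hU.fromSpec ''ᵁ ⊤ = ⊤
        by simp)).op.unop).op)).1
    exact (map_eq_zero_iff _ hinj).mp hz

/-- The universal property of the scheme-theoretic preimage, combined with the fact that factoring
through a closed immersion is containment of kernels. -/
theorem exists_factor_iff_stalkIdeal_le {X Y Z : Scheme.{0}} (f : X ⟶ Y) (i : Z ⟶ Y)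
    [IsClosedImmersion i] (x : X) {Q : CommRingCat.{0}} (ψ : X.presheaf.stalk x ⟶ Q) :
    (∃ l : Spec Q ⟶ Z, (Spec.map ψ ≫ X.fromSpecStalk x) ≫ f = l ≫ i) ↔
      stalkIdeal (Scheme.Hom.ker (pullback.fst f i)) x ≤ RingHom.ker ψ.hom := by
  rw [← le_ker_specMap_fromSpecStalk_iff]
  constructor
  · rintro ⟨l, hl⟩
    rw [← pullback.lift_fst _ _ hl]
    exact Scheme.Hom.le_ker_comp _ _
  · intro h
    have hl := IsClosedImmersion.lift_fac (pullback.fst f i) _ h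
    refine ⟨IsClosedImmersion.lift (pullback.fst f i) _ h ≫ pullback.snd f i, ?_⟩
    exact ((congr($hl ≫ f)).symm.trans (Category.assoc _ _ _)).trans
      (congr(_ ≫ $pullback.condition).trans (Category.assoc _ _ _).symm)

end GeometricDivisibility

end

/-! ### Generic points of the group scheme and sections over local rings. -/

noncomputable section

namespace GeometricDivisibility

/-- The local ring injects into the function field. For reduced source and separated target,
morphisms from the local scheme are therefore determined generically. -/
theorem specMap_stalkSpecializes_isDominant {X : Scheme.{0}} [IsIntegral X] (x : X) :
    IsDominant (Spec.map (X.presheaf.stalkSpecializes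
      ((genericPoint_spec X).specializes (Set.mem_univ x)))) := by
  constructor
  have hinj : Function.Injective (X.presheaf.stalkSpecializes
      ((genericPoint_spec X).specializes (Set.mem_univ x))).hom :=
    IsFractionRing.injective (X.presheaf.stalk x) X.functionField
  exact PrimeSpectrum.denseRange_comap_iff_ker_le_nilRadical _ |>.mpr
    (by rw [(RingHom.injective_iff_ker_eq_bot _).mp hinj]; exact bot_le)

theorem fromSpecStalkOfMem_eq {X : Scheme.{0}} (U : X.Opens) (x : X) (hx : x ∈ U) :
    U.fromSpecStalkOfMem x hx =
      Spec.map (U.stalkIso ⟨x, hx⟩).hom ≫ U.toScheme.fromSpecStalk ⟨x, hx⟩ := by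
  rw [← cancel_mono U.ι, Scheme.Opens.fromSpecStalkOfMem_ι]
  have h := Scheme.SpecMap_stalkMap_fromSpecStalk U.ι (x := ⟨x, hx⟩)
  rw [← Scheme.Opens.stalkIso_inv] at h
  refine Eq.trans ?_ (congr(Spec.map (U.stalkIso ⟨x, hx⟩).hom ≫ $h).trans
    (Category.assoc _ _ _).symm)
  refine Eq.trans ?_ (Category.assoc _ _ _)
  have hid : Spec.map (U.stalkIso ⟨x, hx⟩).hom ≫ Spec.map (U.stalkIso ⟨x, hx⟩).inv = 𝟙 _ := by
    rw [← Spec.map_comp, Iso.inv_hom_id, Spec.map_id]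
  exact (congr($hid ≫ X.fromSpecStalk x).trans (Category.id_comp _)).symm

theorem specMap_stalkSpecializes_fromSpecStalkOfMem {X Y : Scheme.{0}} [IsIntegral X]
    (f : X.PartialMap Y) {x : X} (hx : x ∈ f.domain) :
    Spec.map (X.presheaf.stalkSpecializes ((genericPoint_spec X).specializes (Set.mem_univ x))) ≫
      f.fromSpecStalkOfMem hx = f.fromFunctionField := by
  rw [Scheme.PartialMap.fromFunctionField, Scheme.PartialMap.fromSpecStalkOfMem,
    Scheme.PartialMap.fromSpecStalkOfMem, ← Category.assoc]
  congr 1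
  rw [← cancel_mono f.domain.ι]
  simp

namespace Model

variable {C : Curve} {G : Over C.specK} [GrpObj G] (M : Model C G) (P : C.Points G)

/-- A point of the generic fibre as a morphism over the curve. -/
def genericPt : Over.mk C.generic ⟶ M.𝒢 :=
  Over.homMk (M.genericMap P) (by simpa using M.genericMap_hom P)

/-- The identification of the generic fibre respects multiplication, and multiplication on that
fibre is the base change of the one on `𝒢`; the two sides are compared through both projections of
`𝒢 ⊗ 𝒢`. -/
theorem genericPt_mul (Q : C.Points G) :
    M.genericPt (P * Q) = M.genericPt P * M.genericPt Q := by
  ext1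
  rw [Hom.mul_def (M.genericPt P), Over.comp_left]
  change (P * Q).left ≫ M.genericFibre.inv.left ≫ pullback.fst M.𝒢.hom C.generic = _
  rw [← Category.assoc, ← Over.comp_left]
  rw [MonObj.mul_comp, Hom.mul_def, Over.comp_left, Functor.obj.μ_def, Over.comp_left]
  have : ((Over.pullback C.generic).map μ[M.𝒢]).left ≫ pullback.fst M.𝒢.hom C.generic =
    pullback.fst (M.𝒢 ⊗ M.𝒢).hom C.generic ≫ (μ[M.𝒢]).left := pullback.lift_fst _ _ _
  rw [Category.assoc, Category.assoc, this, ← Category.assoc, ← Category.assoc]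
  congr 1
  apply pullback.hom_ext
  · refine (Category.assoc _ _ _).trans ?_
    refine (congr(_ ≫ $(Over.μ_pullback_left_fst_fst (f := C.generic) M.𝒢 M.𝒢))).trans ?_
    refine Eq.trans ?_ (congr(($(CartesianMonoidalCategory.lift_fst
      (M.genericPt P) (M.genericPt Q))).left)).symm
    have h := congr(($(CartesianMonoidalCategory.lift_fst
      (P ≫ M.genericFibre.inv) (Q ≫ M.genericFibre.inv))).left ≫ pullback.fst M.𝒢.hom C.generic)
    exact ((Category.assoc _ _ _).symm.trans h).trans (Category.assoc _ _ _)
  · refine (Category.assoc _ _ _).trans ?_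
    refine (congr(_ ≫ $(Over.μ_pullback_left_fst_snd (f := C.generic) M.𝒢 M.𝒢))).trans ?_
    refine Eq.trans ?_ (congr(($(CartesianMonoidalCategory.lift_snd
      (M.genericPt P) (M.genericPt Q))).left)).symm
    have h := congr(($(CartesianMonoidalCategory.lift_snd
      (P ≫ M.genericFibre.inv) (Q ≫ M.genericFibre.inv))).left ≫ pullback.fst M.𝒢.hom C.generic)
    exact ((Category.assoc _ _ _).symm.trans h).trans (Category.assoc _ _ _)

theorem genericPt_injective : Function.Injective M.genericPt := by
  intro P Q h
  rw [← cancel_mono M.genericFibre.inv]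
  ext1
  refine pullback.hom_ext (congr(($h).left)) ?_
  exact (Over.w (P ≫ M.genericFibre.inv)).trans (Over.w (Q ≫ M.genericFibre.inv)).symm

/-- Passing to the generic fibre, as a homomorphism of groups. -/
def genericPtHom : C.Points G →* (Over.mk C.generic ⟶ M.𝒢) :=
  MonoidHom.mk' M.genericPt M.genericPt_mul

/-- The local scheme of the curve at `c`. -/
abbrev _root_.GeometricDivisibility.Curve.localScheme (C : Curve) (c : C.X) : Over C.X :=
  Over.mk (C.X.fromSpecStalk c)

instance (c : C.X) : IsReduced (C.localScheme c).left :=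
  inferInstanceAs (IsReduced (Spec (C.X.presheaf.stalk c)))

/-- The inclusion of the generic point into the local scheme at `c`. -/
def _root_.GeometricDivisibility.Curve.genericToLocal (C : Curve) (c : C.X) :
    Over.mk C.generic ⟶ C.localScheme c :=
  Over.homMk (Spec.map (C.X.presheaf.stalkSpecializes
    ((genericPoint_spec C.X).specializes (Set.mem_univ c)))) (by simp)

theorem sectionOf_fromFunctionField :
    (M.sectionOf P).fromFunctionField = M.genericMap P := by
  rw [← Scheme.RationalMap.fromFunctionField_toRationalMap, sectionOf,
    Scheme.RationalMap.toRationalMap_toPartialMap,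
    Scheme.RationalMap.fromFunctionField_ofFunctionField]

/-- The section `σ_P` over the local scheme of the curve at a point of its domain. -/
def localSection {c : C.X} (hc : c ∈ (M.sectionOf P).domain) : C.localScheme c ⟶ M.𝒢 :=
  Over.homMk ((M.sectionOf P).fromSpecStalkOfMem hc) (by
    have := specMap_stalkSpecializes_isDominant c
    refine ext_of_isDominant (Spec.map (C.X.presheaf.stalkSpecializes
      ((genericPoint_spec C.X).specializes (Set.mem_univ c)))) ?_
    dsimp
    rw [← Category.assoc, specMap_stalkSpecializes_fromSpecStalkOfMem,
      sectionOf_fromFunctionField, genericMap_hom]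
    exact (Category.comp_id _).trans (Scheme.SpecMap_stalkSpecializes_fromSpecStalk _).symm)

theorem genericToLocal_localSection {c : C.X} (hc : c ∈ (M.sectionOf P).domain) :
    C.genericToLocal c ≫ M.localSection P hc = M.genericPt P := by
  ext1
  exact (specMap_stalkSpecializes_fromSpecStalkOfMem _ _).trans
    (M.sectionOf_fromFunctionField P)

/-- Because `𝒢` is locally of finite type, a section over the local ring spreads out to a
neighbourhood of c, which the maximal domain must contain. -/
theorem mem_domain_of_genericToLocal {c : C.X} (τ : C.localScheme c ⟶ M.𝒢)
    (h : C.genericToLocal c ≫ τ = M.genericPt P) : c ∈ (M.sectionOf P).domain := by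
  have hτ : τ.left ≫ M.𝒢.hom = C.X.fromSpecStalk c ≫ 𝟙 C.X := by simp
  let f := Scheme.PartialMap.ofFromSpecStalk (𝟙 C.X) M.𝒢.hom τ.left hτ
  have hf : f.toRationalMap = Scheme.RationalMap.ofFunctionField (𝟙 C.X) M.𝒢.hom (M.genericMap P)
      (M.genericMap_hom P) := by
    apply Scheme.RationalMap.eq_of_fromFunctionField_eq
    rw [Scheme.RationalMap.fromFunctionField_ofFunctionField,
      Scheme.RationalMap.fromFunctionField_toRationalMap,
      ← specMap_stalkSpecializes_fromSpecStalkOfMem f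
        (Scheme.PartialMap.mem_domain_ofFromSpecStalk _ _ _ _),
      Scheme.PartialMap.fromSpecStalkOfMem_ofFromSpecStalk]
    exact congr(($h).left)
  have := f.le_domain_toRationalMap (Scheme.PartialMap.mem_domain_ofFromSpecStalk _ _ _ _)
  rw [hf] at this
  exact this

theorem genericToLocal_injective {c : C.X} {τ τ' : C.localScheme c ⟶ M.𝒢}
    (h : C.genericToLocal c ≫ τ = C.genericToLocal c ≫ τ') : τ = τ' := by
  have := specMap_stalkSpecializes_isDominant c
  ext1
  exact ext_of_isDominant (Spec.map (C.X.presheaf.stalkSpecializes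
      ((genericPoint_spec C.X).specializes (Set.mem_univ c)))) congr(($h).left)

instance : IsClosedImmersion M.identitySection := by
  have : IsClosedImmersion (M.identitySection ≫ M.𝒢.hom) := by
    have : M.identitySection ≫ M.𝒢.hom = 𝟙 _ := Over.w (MonObj.one (X := M.𝒢))
    rw [this]; infer_instance
  exact .of_comp M.identitySection M.𝒢.hom

/-- The ideal of the local ring of the curve at `c` that defines the intersection of `σ_P` and the
identity section. -/
def localIdeal {c : C.X} (hc : c ∈ (M.sectionOf P).domain) : Ideal (C.X.presheaf.stalk c) :=
  (stalkIdeal (M.intersection P) ⟨c, hc⟩).map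
    ((M.sectionOf P).domain.stalkIso ⟨c, hc⟩).commRingCatIsoToRingEquiv

theorem ord_eq_length {c : C.X} (hc : c ∈ (M.sectionOf P).domain) :
    M.ord P c = Module.length (C.X.presheaf.stalk c) (C.X.presheaf.stalk c ⧸ M.localIdeal P hc) := by
  exact (dif_pos hc).trans (Ideal.length_quotient_map_ringEquiv _ _).symm

/-- The universal property of J, through which the group law acts on ideals. -/
theorem localIdeal_le_ker_iff {c : C.X} (hc : c ∈ (M.sectionOf P).domain) {Q : CommRingCat.{0}}
    (ψ : C.X.presheaf.stalk c ⟶ Q) :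
    M.localIdeal P hc ≤ RingHom.ker ψ.hom ↔
      Spec.map ψ ≫ (M.localSection P hc).left =
        Spec.map ψ ≫ (1 : C.localScheme c ⟶ M.𝒢).left := by
  let j := ((M.sectionOf P).domain.stalkIso ⟨c, hc⟩).hom
  have h1 : M.localIdeal P hc ≤ RingHom.ker ψ.hom ↔
      stalkIdeal (M.intersection P) ⟨c, hc⟩ ≤ RingHom.ker (j ≫ ψ).hom :=
    Ideal.map_le_iff_le_comap
  refine h1.trans ((exists_factor_iff_stalkIdeal_le _ _ _ (j ≫ ψ)).symm.trans ?_)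
  have h2 : (Spec.map (j ≫ ψ) ≫ (M.sectionOf P).domain.toScheme.fromSpecStalk ⟨c, hc⟩) ≫
      (M.sectionOf P).hom = Spec.map ψ ≫ (M.localSection P hc).left := by
    rw [Spec.map_comp, Category.assoc, Category.assoc, ← Category.assoc (Spec.map j),
      ← fromSpecStalkOfMem_eq]
    rfl
  have h3 : (1 : C.localScheme c ⟶ M.𝒢).left = C.X.fromSpecStalk c ≫ M.identitySection := rfl
  have h4 : M.identitySection ≫ M.𝒢.hom = 𝟙 _ := Over.w (MonObj.one (X := M.𝒢))
  have h5 : (M.localSection P hc).left ≫ M.𝒢.hom = C.X.fromSpecStalk c :=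
    Over.w (M.localSection P hc)
  rw [h2, h3]
  constructor
  · rintro ⟨l, hl⟩
    -- Projecting to the curve forces l to be the structure map of Spec Q, so factoring through the
    -- identity section means being the identity point.
    have := congr($hl ≫ M.𝒢.hom)
    rw [Category.assoc, Category.assoc, h4, Category.comp_id, h5] at this
    rw [hl, ← this, Category.assoc]
  · intro h
    exact ⟨_, h.trans (Category.assoc _ _ _).symm⟩

end Model
end GeometricDivisibility
end

/-! ### Local rings of the curve, and the comparison of P with its multiples. -/

noncomputable section

namespace GeometricDivisibility

namespace Curve

variable (C : Curve) (c : C.X)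

theorem isUnit_natCast_stalk {n : ℕ} (hn : n ≠ 0) : IsUnit (n : C.X.presheaf.stalk c) := by
  let f := Spec.preimage (C.X.fromSpecStalk c ≫ C.π)
  have h : IsUnit (n : AlgebraicClosure ℚ) := (Nat.cast_ne_zero.mpr hn).isUnit
  have := h.map f.hom
  rwa [map_natCast] at this

theorem isNoetherianRing_and_dimensionLEOne_stalk :
    IsNoetherianRing (C.X.presheaf.stalk c) ∧ Ring.DimensionLEOne (C.X.presheaf.stalk c) := by
  obtain ⟨U, hU, V, hV, hcV, e, hf⟩ :=
    SmoothOfRelativeDimension.exists_isStandardSmoothOfRelativeDimension (n := 1) (f := C.π) c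
  have : Nonempty V := ⟨⟨c, hcV⟩⟩
  -- The base is the spectrum of a field, a single point, so the smooth chart is an algebra over the
  -- whole field.
  have hUtop : U = ⊤ := by
    have : Subsingleton (Spec (.of (AlgebraicClosure ℚ))) :=
      inferInstanceAs (Subsingleton (PrimeSpectrum (AlgebraicClosure ℚ)))
    exact eq_top_iff.mpr fun y _ => Subsingleton.elim (C.π c) y ▸ e hcV
  subst hUtop
  let k := AlgebraicClosure ℚ
  let eK : k ≃+* Γ(Spec (.of k), ⊤) := (Scheme.ΓSpecIso (.of k)).symm.commRingCatIsoToRingEquiv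
  let : Field Γ(Spec (.of k), ⊤) := (eK.toMulEquiv.symm.isField (Field.toIsField k)).toField
  algebraize [(C.π.appLE ⊤ V e).hom]
  have : Algebra.IsStandardSmoothOfRelativeDimension 1 Γ(Spec (.of k), ⊤) Γ(C.X, V) := hf
  have : Ring.DimensionLEOne Γ(C.X, V) :=
    Algebra.IsStandardSmoothOfRelativeDimension.dimensionLEOne Γ(Spec (.of k), ⊤) _
  have := Algebra.IsStandardSmoothOfRelativeDimension.isStandardSmooth 1
    (R := Γ(Spec (.of k), ⊤)) (S := Γ(C.X, V))
  have : IsNoetherianRing Γ(C.X, V) := Algebra.FiniteType.isNoetherianRing Γ(Spec (.of k), ⊤) _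
  let := C.X.presheaf.algebra_section_stalk ⟨c, hcV⟩
  have hloc : IsLocalization.AtPrime (C.X.presheaf.stalk c) (hV.primeIdealOf ⟨c, hcV⟩).asIdeal :=
    hV.isLocalization_stalk ⟨c, hcV⟩
  refine ⟨IsLocalization.isNoetherianRing (hV.primeIdealOf ⟨c, hcV⟩).asIdeal.primeCompl _
    inferInstance, ?_⟩
  exact Ring.DimensionLEOne.localization _
    (Ideal.primeCompl_le_nonZeroDivisors (hV.primeIdealOf ⟨c, hcV⟩).asIdeal)

end Curve

namespace Model

variable {C : Curve} {G : Over C.specK} [GrpObj G] (M : Model C G) (P : C.Points G) {c : C.X}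

theorem genericToLocal_localSection_zpow (hc : c ∈ (M.sectionOf P).domain) (n : ℤ) :
    C.genericToLocal c ≫ M.localSection P hc ^ n = M.genericPt (P ^ n) := by
  rw [GrpObj.comp_zpow, genericToLocal_localSection]
  exact (map_zpow M.genericPtHom P n).symm

theorem mem_domain_zpow (hc : c ∈ (M.sectionOf P).domain) (n : ℤ) :
    c ∈ (M.sectionOf (P ^ n)).domain :=
  M.mem_domain_of_genericToLocal _ _ (M.genericToLocal_localSection_zpow P hc n)

/-- Both sections restrict to nP at the generic point. -/
theorem localSection_zpow (hc : c ∈ (M.sectionOf P).domain) (n : ℤ) :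
    M.localSection (P ^ n) (M.mem_domain_zpow P hc n) = M.localSection P hc ^ n :=
  M.genericToLocal_injective (by
    rw [genericToLocal_localSection, genericToLocal_localSection_zpow])

/-- Change of rings as a morphism over the curve. -/
def specMapLocal {Q : CommRingCat.{0}} (ψ : C.X.presheaf.stalk c ⟶ Q) :
    Over.mk (Spec.map ψ ≫ C.X.fromSpecStalk c) ⟶ C.localScheme c :=
  Over.homMk (Spec.map ψ)

theorem localIdeal_le_ker_iff_comp_eq_one (hc : c ∈ (M.sectionOf P).domain) {Q : CommRingCat.{0}}
    (ψ : C.X.presheaf.stalk c ⟶ Q) :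
    M.localIdeal P hc ≤ RingHom.ker ψ.hom ↔ specMapLocal ψ ≫ M.localSection P hc = 1 := by
  rw [localIdeal_le_ker_iff, ← MonObj.comp_one (specMapLocal ψ)]
  exact ⟨fun h => Over.OverMorphism.ext h, fun h => congr(($h).left)⟩

theorem localIdeal_zpow (hc : c ∈ (M.sectionOf P).domain) (h : M.localIdeal P hc ≠ ⊤) {n : ℤ}
    (hn : n ≠ 0) :
    M.localIdeal (P ^ n) (M.mem_domain_zpow P hc n) = M.localIdeal P hc := by
  let J := M.localIdeal P hc
  let J' := M.localIdeal (P ^ n) (M.mem_domain_zpow P hc n)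
  have hle : J' ≤ J := by
    let ψ : C.X.presheaf.stalk c ⟶ .of (C.X.presheaf.stalk c ⧸ J) :=
      CommRingCat.ofHom (Ideal.Quotient.mk J)
    have hψ : RingHom.ker ψ.hom = J := Ideal.mk_ker
    have h1 := (M.localIdeal_le_ker_iff_comp_eq_one P hc ψ).mp hψ.ge
    have h2 := (M.localIdeal_le_ker_iff_comp_eq_one (P ^ n) (M.mem_domain_zpow P hc n) ψ).mpr
      (by rw [M.localSection_zpow P hc, GrpObj.comp_zpow, h1, one_zpow])
    exact h2.trans hψ.le
  refine le_antisymm hle ?_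
  -- Adding J² makes J/K square-zero, and Nakayama later removes it; containing J' keeps nP trivial
  -- modulo K.
  let K := J' ⊔ J • J
  have hKJ : K ≤ J := sup_le hle Ideal.mul_le_left
  let ψ : C.X.presheaf.stalk c ⟶ .of (C.X.presheaf.stalk c ⧸ K) :=
      CommRingCat.ofHom (Ideal.Quotient.mk K)
  have hψ : RingHom.ker ψ.hom = K := Ideal.mk_ker
  let q : CommRingCat.of (C.X.presheaf.stalk c ⧸ K) ⟶ .of (C.X.presheaf.stalk c ⧸ J) :=
    CommRingCat.ofHom (Ideal.Quotient.factor hKJ)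
  have : Nontrivial (C.X.presheaf.stalk c ⧸ K) :=
    Ideal.Quotient.nontrivial_iff.mpr fun hK => h (top_le_iff.mp (hK ▸ hKJ))
  have hloc : IsLocalRing (CommRingCat.of (C.X.presheaf.stalk c ⧸ K)) :=
    IsLocalRing.of_surjective' (Ideal.Quotient.mk K) Ideal.Quotient.mk_surjective
  let f := specMapLocal ψ ≫ M.localSection P hc
  -- Passing to the absolute value covers negative n, the tangent computation being for natural
  -- powers.
  have hfn : f ^ n.natAbs = 1 := by
    rw [pow_natAbs_eq_one]
    have := (M.localIdeal_le_ker_iff_comp_eq_one (P ^ n) (M.mem_domain_zpow P hc n) ψ).mp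
      (le_sup_left.trans hψ.ge)
    rwa [localSection_zpow, GrpObj.comp_zpow] at this
  have hf : f = 1 := by
    refine eq_one_of_pow_eq_one _ q (Ideal.Quotient.factor_surjective hKJ) ?_ f ?_ n.natAbs ?_ hfn
    · intro a b ha hb
      obtain ⟨a, rfl⟩ := Ideal.Quotient.mk_surjective a
      obtain ⟨b, rfl⟩ := Ideal.Quotient.mk_surjective b
      replace ha : a ∈ J := Ideal.Quotient.eq_zero_iff_mem.mp ha
      replace hb : b ∈ J := Ideal.Quotient.eq_zero_iff_mem.mp hb
      rw [← map_mul]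
      exact Ideal.Quotient.eq_zero_iff_mem.mpr
        ((le_sup_right : J • J ≤ K) (Ideal.mul_mem_mul ha hb))
    · have hψq : RingHom.ker (ψ ≫ q).hom = J := by
        have : (ψ ≫ q).hom = Ideal.Quotient.mk J := Ideal.Quotient.factor_comp_mk hKJ
        rw [this, Ideal.mk_ker]
      have := (M.localIdeal_le_ker_iff P hc (ψ ≫ q)).mp hψq.ge
      rw [Spec.map_comp, Category.assoc, Category.assoc] at this
      refine this.trans ?_
      rw [← MonObj.comp_one (specMapLocal ψ)]
      rfl
    · have := (C.isUnit_natCast_stalk c (Int.natAbs_ne_zero.mpr hn)).map ψ.hom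
      rwa [map_natCast] at this
  have hJK : J ≤ K := ((M.localIdeal_le_ker_iff_comp_eq_one P hc ψ).mpr hf).trans hψ.le
  have := (C.isNoetherianRing_and_dimensionLEOne_stalk c).1
  exact Submodule.le_of_le_smul_of_le_jacobson_bot (IsNoetherian.noetherian J)
    ((IsLocalRing.le_maximalIdeal h).trans (IsLocalRing.jacobson_eq_maximalIdeal ⊥ bot_ne_top).ge)
    hJK

theorem one_le_ord_iff (hc : c ∈ (M.sectionOf P).domain) :
    1 ≤ M.ord P c ↔ M.localIdeal P hc ≠ ⊤ := by
  rw [ord_eq_length, Order.one_le_iff_ne_zero, ne_eq, Module.length_eq_zero_iff,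
    Submodule.Quotient.subsingleton_iff, ne_eq]

theorem mem_domain_of_one_le_ord (h : 1 ≤ M.ord P c) : c ∈ (M.sectionOf P).domain := by
  by_contra hc
  rw [ord, dif_neg hc] at h
  simp at h

theorem ord_zpow (h : 1 ≤ M.ord P c) {n : ℤ} (hn : n ≠ 0) : M.ord (P ^ n) c = M.ord P c := by
  have hc := M.mem_domain_of_one_le_ord P h
  rw [ord_eq_length _ _ hc, ord_eq_length _ _ (M.mem_domain_zpow P hc n),
    M.localIdeal_zpow P hc ((M.one_le_ord_iff P hc).mp h) hn]

/-- If J were zero, the section over the local ring would be the identity, hence so would P at the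
generic point. A nonzero J has finite colength. -/
theorem ord_ne_top (hP : P ≠ 1) : M.ord P c ≠ ⊤ := by
  by_cases hc : c ∈ (M.sectionOf P).domain
  · obtain ⟨_, _⟩ := C.isNoetherianRing_and_dimensionLEOne_stalk c
    rw [ord_eq_length _ _ hc, Module.length_ne_top_iff]
    refine Ideal.isFiniteLength_quotient fun h => hP (M.genericPt_injective ?_)
    have h1 := (M.localIdeal_le_ker_iff P hc (𝟙 _)).mp (h.trans_le bot_le)
    have h2 : M.localSection P hc = 1 := by
      ext1
      simpa using h1
    rw [← genericToLocal_localSection _ _ hc, h2, MonObj.comp_one]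
    exact (map_one M.genericPtHom).symm
  · rw [ord, dif_neg hc]
    exact ENat.zero_ne_top

end Model

end GeometricDivisibility

end

/-! ### The theorem. -/

theorem mainTheorem6 (C : GeometricDivisibility.Curve)
    (G : Over C.specK) [GrpObj G] [LocallyOfFiniteType G.hom] [QuasiCompact G.hom]
    [ConnectedSpace G.left]
    (M : GeometricDivisibility.Model C G)
    (P : C.Points G) (hP : ¬ IsOfFinOrder P)
    (c : C.X) (hc : IsClosed ({c} : Set C.X)) :
    (1 ≤ M.ord P c → ∀ n : ℤ, n ≠ 0 → M.ord (P ^ n) c = M.ord P c) ∧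
    ∃ m : ℕ, ∀ n : ℤ, n ≠ 0 → M.ord (P ^ n) c = 0 ∨ M.ord (P ^ n) c = m := by
  refine ⟨fun h n hn => M.ord_zpow P h hn, ?_⟩
  by_cases h : ∃ n : ℤ, n ≠ 0 ∧ M.ord (P ^ n) c ≠ 0
  · obtain ⟨k, hk, hk'⟩ := h
    have hPk : P ^ k ≠ 1 := fun h => hP (isOfFinOrder_iff_zpow_eq_one.mpr ⟨k, hk, h⟩)
    obtain ⟨m, hm⟩ := ENat.ne_top_iff_exists.mp (M.ord_ne_top (P ^ k) (c := c) hPk)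
    refine ⟨m, fun n hn => or_iff_not_imp_left.mpr fun hn' => ?_⟩
    -- Both orders are positive, so each equals the order of the common multiple nkP.
    rw [hm, ← M.ord_zpow (P ^ n) (Order.one_le_iff_ne_zero.mpr hn') hk,
      ← M.ord_zpow (P ^ k) (Order.one_le_iff_ne_zero.mpr hk') hn, ← zpow_mul, ← zpow_mul, mul_comm]
  · push Not at h
    exact ⟨0, fun n hn => Or.inl (h n hn)⟩
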